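/- Let $\mathcal H$ be the upper half plane and $\mathrm{Hol}$ the space of holomorphic functions on $\mathcal H$. Write $f'=\frac{1}{2\pi i}\frac{df}{dz}$, let $E_2,E_4,E_6$ be the normalized Eisenstein series of $\mathrm{SL}(2,\mathbb Z)$, put $D_kf=f'-\frac{k}{12}E_2f$ for $k\in\mathbb R$, and $D_k^{[0]}=1$, $D_k^{[n]}=D_{k+2n-2}\cdots D_{k+2}D_k$. A monic modular linear differential equation (monic MLDE) of weight $k$ is an equation $$D_k^{[n]}f+g_1D_k^{[n-1]}f+\cdots+g_{n-1}D_kf+g_nf=0$$ with $n\ge 0$, where each $g_i$ is a holomorphic modular form of weight $2i$ on $\mathrm{SL}(2,\mathbb Z)$. Let $\Sigma_k$ be the set of $f\in\mathrm{Hol}$ satisfying some monic MLDE of weight $k$. For $f\in\mathrm{Hol}$ let $\mathrm{dwt}(f)\in\mathbb Z\cup\{\pm\infty\}$ be the largest $k\in\mathbb Z$ with $f\in\Sigma_k$; here $\mathrm{dwt}(f)=\infty$ if the set of such integers $k$ is unbounded above, and $\mathrm{dwt}(f)=-\infty$ if it is empty. A quasimodular form of weight $k$ and depth $s$ is a function $P(E_2,E_4,E_6)$,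 where $P$ is a complex polynomial that is homogeneous of weight $k$ when its variables are given the weights $2,4,6$, and that has degree $s$ in the first variable. **Theorem.** Let $f,g\in\mathrm{Hol}$. 1. $\mathrm{dwt}(fg)\ge\mathrm{dwt}(f)+\mathrm{dwt}(g)$, where $\infty+(-\infty):=-\infty$. 2. If $\mathrm{dwt}(f)=\mathrm{dwt}(g)$, then $\mathrm{dwt}(f+g)\ge\mathrm{dwt}(g)$. 3. If $\mathrm{dwt}(f)>\mathrm{dwt}(g)$, then $\mathrm{dwt}(f+g)=\mathrm{dwt}(g)$. 4. If $f$ is a nonzero quasimodular form of weight $k$ and depth $s$, then $\mathrm{dwt}(f)=k-s$; in particular $f$ satisfies a monic MLDE of weight $k-s$, and satisfies none of any integral weight $m>k-s$. -/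

import Mathlib

open scoped MatrixGroups Manifold
open UpperHalfPlane

noncomputable section

namespace MLDE

/-- The iterated Ramanujan-Serre derivative `D_{k+2n-2} ∘ ⋯ ∘ D_{k+2} ∘ D_k`, where
`D_k f = (2πi)⁻¹ df/dz - (k/12) E₂ f`. -/
def iterSerre (k : ℝ) : ℕ → (ℍ → ℂ) → (ℍ → ℂ)
  | 0, f => f
  | n + 1, f => Derivative.serreDerivative ((k + 2 * n : ℝ) : ℂ) (iterSerre k n f)

/-- `f` solves a monic modular linear differential equation of weight `k` and order `n`:
`D^n f + g₁ D^{n-1} f + ⋯ + gₙ f = 0` with `gᵢ` a holomorphic modular form of weight `2i` on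
`SL(2, ℤ)` (only `g 1, …, g n` are used). -/
def SolvesMonicMLDE (k : ℝ) (n : ℕ) (f : ℍ → ℂ) : Prop :=
  ∃ g : (i : ℕ) → ModularForm 𝒮ℒ (2 * (i : ℤ)),
    ∀ z : ℍ, iterSerre k n f z + ∑ i ∈ Finset.Icc 1 n, g i z * iterSerre k (n - i) f z = 0

/-- `Σ_k`: the holomorphic functions on the upper half plane that satisfy some monic modular
linear differential equation of weight `k`. -/
def SigmaSet (k : ℝ) : Set (ℍ → ℂ) :=
  {f | MDiff f ∧ ∃ n : ℕ, SolvesMonicMLDE k n f}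

/-- The differential weight, with values in `ℤ ∪ {-∞, ∞}`: the largest integer `k` with
`f ∈ Σ_k`, which is `-∞` (`⊥`) if there is no such integer and `∞` (`⊤`) if such integers are
unbounded above. Addition on `WithBot (WithTop ℤ)` satisfies `⊤ + ⊥ = ⊥`. -/
def dwt (f : ℍ → ℂ) : WithBot (WithTop ℤ) :=
  sSup {x | ∃ k : ℤ, f ∈ SigmaSet (k : ℝ) ∧ x = ((k : WithTop ℤ) : WithBot (WithTop ℤ))}

theorem dwt_eq_bot_iff (f : ℍ → ℂ) : dwt f = ⊥ ↔ ∀ k : ℤ, f ∉ SigmaSet (k : ℝ) := by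
  simp only [dwt, sSup_eq_bot, Set.mem_ofPred_eq]
  constructor
  · intro h k hk
    exact WithBot.coe_ne_bot (h _ ⟨k, hk, rfl⟩)
  · rintro h x ⟨k, hk, -⟩
    exact absurd hk (h k)

theorem dwt_eq_coe_iff (f : ℍ → ℂ) (k : ℤ) :
    dwt f = ((k : WithTop ℤ) : WithBot (WithTop ℤ)) ↔
      IsGreatest {m : ℤ | f ∈ SigmaSet (m : ℝ)} k := by
  constructor
  · intro h
    have hub : ∀ m : ℤ, f ∈ SigmaSet (m : ℝ) → m ≤ k := by
      intro m hm
      have : ((m : WithTop ℤ) : WithBot (WithTop ℤ)) ≤ dwt f := le_sSup ⟨m, hm, rfl⟩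
      rw [h] at this
      exact_mod_cast this
    refine ⟨?_, fun m hm => hub m hm⟩
    by_contra hk
    have hle : dwt f ≤ (((k - 1 : ℤ) : WithTop ℤ) : WithBot (WithTop ℤ)) := by
      refine sSup_le ?_
      rintro x ⟨m, hm, rfl⟩
      have h1 := hub m hm
      have h2 : m ≠ k := by
        rintro rfl
        exact hk hm
      have h3 : m ≤ k - 1 := by omega
      exact_mod_cast h3
    rw [h] at hle
    have : k ≤ k - 1 := by exact_mod_cast hle
    omega
  · rintro ⟨hk, hub⟩
    refine le_antisymm (sSup_le ?_) (le_sSup ⟨k, hk, rfl⟩)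
    rintro x ⟨m, hm, rfl⟩
    exact_mod_cast hub hm

/-- `f` is a quasimodular form of weight `k` and depth `s`: it is `P(E₂, E₄, E₆)` for a complex
polynomial `P`, homogeneous of weight `k` when the variables have weights `2, 4, 6`, whose degree
in the first variable is `s`. -/
def IsQuasimodular (k s : ℕ) (f : ℍ → ℂ) : Prop :=
  ∃ P : MvPolynomial (Fin 3) ℂ,
    P.IsWeightedHomogeneous (![2, 4, 6] : Fin 3 → ℕ) k ∧ P.degreeOf 0 = s ∧
      ∀ z : ℍ, f z =
        MvPolynomial.eval ![EisensteinSeries.E2 z, ModularForm.E₄ z, ModularForm.E₆ z] P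

end MLDE

end

/-! The key is a finiteness criterion: `f ∈ SigmaSet k` exactly when `f` is a weight `k` element of
a finitely generated graded module over M = ℂ[E₄, E₆] that is stable under the Serre derivative. If
`f` solves an equation of order `n`, its iterated derivatives below `n` generate such a module
(`exists_isDClosed_of_mem_SigmaSet`). Conversely, M is Noetherian, so some iterate of `f` depends
M-linearly on the earlier ones; the homogeneous part of this relation is a monic MLDE
(`mem_SigmaSet_of_mem_gradedSpan`).

Sums and products of solutions then come from unions and pairwise products of generators. Since D₋₁1
= E₂/12 and D₁E₂ is a modular form, `1` and `E2` in weights -1 and 1 generate a stable module. Hence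
`1 ∈ SigmaSet (-1)`, multiplication by `1` makes `SigmaSet` antitone, and `n ≤ dwt f` means `f ∈
SigmaSet n`. The first three claims follow formally.

For depth `s`, the powers `E2 ^ i` with `i ≤ s`, in weights `2 * i - s`, give membership in weight
`k - s`. In a larger weight each Serre derivative raises the depth by exactly one, so the top term
of an MLDE cannot cancel: `E2` is independent over M. -/

noncomputable section

namespace MLDE

open Derivative ModularForm EisensteinSeries

/-! ### Level one modular forms as functions -/

/-- The space of level one modular forms of weight `k`, as functions on the upper half plane. -/
def modForms (k : ℤ) : Submodule ℂ (ℍ → ℂ) where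
  carrier := {f | ∃ F : ModularForm 𝒮ℒ k, (F : ℍ → ℂ) = f}
  add_mem' := by
    rintro _ _ ⟨F, rfl⟩ ⟨G, rfl⟩
    exact ⟨F + G, rfl⟩
  zero_mem' := ⟨0, rfl⟩
  smul_mem' := by
    rintro c _ ⟨F, rfl⟩
    exact ⟨c • F, rfl⟩

theorem coe_mem_modForms {k : ℤ} (F : ModularForm 𝒮ℒ k) : (F : ℍ → ℂ) ∈ modForms k := ⟨F, rfl⟩

theorem mul_mem_modForms {k l : ℤ} {f g : ℍ → ℂ} (hf : f ∈ modForms k) (hg : g ∈ modForms l) :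
    f * g ∈ modForms (k + l) := by
  obtain ⟨F, rfl⟩ := hf
  obtain ⟨G, rfl⟩ := hg
  exact ⟨F.mul G, rfl⟩

theorem one_mem_modForms : (1 : ℍ → ℂ) ∈ modForms 0 := ⟨1, rfl⟩

theorem pow_mem_modForms {k : ℤ} {f : ℍ → ℂ} (hf : f ∈ modForms k) (n : ℕ) :
    f ^ n ∈ modForms (n * k) := by
  induction n with
  | zero => simpa using one_mem_modForms
  | succ n ih =>
    rw [pow_succ, show ((n + 1 : ℕ) : ℤ) * k = n * k + k by push_cast; ring]
    exact mul_mem_modForms ih hf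

theorem mdiff_of_mem_modForms {k : ℤ} {f : ℍ → ℂ} (hf : f ∈ modForms k) : MDiff f := by
  obtain ⟨F, rfl⟩ := hf
  exact F.holo'

theorem slash_of_mem_modForms {k : ℤ} {f : ℍ → ℂ} (hf : f ∈ modForms k) (γ : SL(2, ℤ)) :
    f ∣[k] γ = f := by
  obtain ⟨F, rfl⟩ := hf
  exact F.slash_action_eq' _ ⟨γ, rfl⟩

theorem isBoundedAtImInfty_of_mem_modForms {k : ℤ} {f : ℍ → ℂ} (hf : f ∈ modForms k) :
    IsBoundedAtImInfty f := by
  obtain ⟨F, rfl⟩ := hf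
  exact ModularFormClass.bdd_at_infty F

theorem mem_modForms_of {k : ℤ} {f : ℍ → ℂ} (hf : MDiff f) (hs : ∀ γ : SL(2, ℤ), f ∣[k] γ = f)
    (hb : IsBoundedAtImInfty f) : f ∈ modForms k :=
  ⟨{ toFun := f
     slash_action_eq' := fun _ ⟨γ, hγ⟩ ↦ hγ ▸ hs γ
     holo' := hf
     bdd_at_cusps' := fun {c} hc ↦ by
      rw [Subgroup.IsArithmetic.isCusp_iff_isCusp_SL2Z] at hc
      rw [OnePoint.isBoundedAt_iff_forall_SL2Z hc]
      intro γ _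
      have := hs γ
      rw [this]
      exact hb }, rfl⟩

/-! ### Serre derivatives of modular forms and of E₂ -/

/-- Cauchy's estimate on unit discs, which stay inside the region of boundedness once the centre is
high enough. -/
theorem isBoundedAtImInfty_normalizedDeriv {f : ℍ → ℂ} (hf : MDiff f)
    (hb : IsBoundedAtImInfty f) : IsBoundedAtImInfty (normalizedDerivOfComplex f) := by
  rw [isBoundedAtImInfty_iff] at hb ⊢
  obtain ⟨C, A, h⟩ := hb
  refine ⟨‖(2 * Real.pi * Complex.I : ℂ)⁻¹‖ * (C / 1), max A 0 + 2, fun z hz ↦ ?_⟩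
  rw [normalizedDerivOfComplex, norm_mul]
  refine mul_le_mul_of_nonneg_left ?_ (norm_nonneg _)
  have him : ∀ w ∈ Metric.closedBall (z : ℂ) 1, max A 0 < w.im := by
    intro w hw
    have h1 : |(w - z).im| ≤ 1 :=
      (Complex.abs_im_le_norm _).trans (by simpa [dist_eq_norm] using hw)
    have h2 := (abs_le.mp h1).1
    have h3 : (z : ℂ).im = z.im := rfl
    simp only [Complex.sub_im] at h2
    linarith
  refine Complex.norm_deriv_le_of_forall_mem_sphere_norm_le one_pos ?_ ?_
  · refine DifferentiableOn.diffContOnCl_ball (U := {w : ℂ | 0 < w.im}) ?_ ?_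
    · exact UpperHalfPlane.mdifferentiable_iff.mp hf
    · intro w hw
      exact (le_max_right _ _).trans_lt (him w hw)
  · intro w hw
    have hw' := him w (Metric.sphere_subset_closedBall hw)
    have hpos : 0 < w.im := (le_max_right _ _).trans_lt hw'
    rw [Function.comp_apply, ofComplex_apply_of_im_pos hpos]
    exact h _ ((le_max_left _ _).trans hw'.le)

/-- The Serre derivative of integral weight. -/
def sD (k : ℤ) (f : ℍ → ℂ) : ℍ → ℂ := serreDerivative (k : ℂ) f

theorem sD_eq (k : ℤ) (f : ℍ → ℂ) :
    sD k f = normalizedDerivOfComplex f - ((k : ℂ) * 12⁻¹) • (E2 * f) := by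
  ext z
  simp [sD]
  ring

theorem mdiff_sD {k : ℤ} {f : ℍ → ℂ} (hf : MDiff f) : MDiff (sD k f) :=
  serreDerivative_mdifferentiable _ hf

theorem sD_add {k : ℤ} {f g : ℍ → ℂ} (hf : MDiff f) (hg : MDiff g) :
    sD k (f + g) = sD k f + sD k g := serreDerivative_add _ _ _ hf hg

theorem sD_zero (k : ℤ) : sD k 0 = 0 := by
  have := serreDerivative_smul (k : ℂ) 0 (0 : ℍ → ℂ) mdifferentiable_const
  rwa [zero_smul, zero_smul] at this

theorem sD_mul {k l : ℤ} {f g : ℍ → ℂ} (hf : MDiff f) (hg : MDiff g) :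
    sD (k + l) (f * g) = sD k f * g + f * sD l g := by
  rw [sD, sD, sD, Int.cast_add]
  exact serreDerivative_mul _ _ _ _ hf hg

theorem isBoundedAtImInfty_sD {k : ℤ} {f : ℍ → ℂ} (hf : MDiff f) (hb : IsBoundedAtImInfty f) :
    IsBoundedAtImInfty (sD k f) := by
  rw [sD_eq]
  exact (isBoundedAtImInfty_normalizedDeriv hf hb).sub
    ((isBoundedAtImInfty_E2.mul hb).const_smul_left _)

theorem sD_mem_modForms {k : ℤ} {f : ℍ → ℂ} (hf : f ∈ modForms k) : sD k f ∈ modForms (k + 2) :=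
  mem_modForms_of (mdiff_sD (mdiff_of_mem_modForms hf))
    (fun γ ↦ serreDerivative_slash_invariant (mdiff_of_mem_modForms hf)
      (slash_of_mem_modForms hf γ))
    (isBoundedAtImInfty_sD (mdiff_of_mem_modForms hf) (isBoundedAtImInfty_of_mem_modForms hf))

theorem E2_slash_apply (γ : SL(2, ℤ)) (z : ℍ) : (E2 ∣[(2 : ℤ)] γ) z =
    E2 z + 12 * ((2 * Real.pi * Complex.I)⁻¹ * (γ 1 0 / denom γ z)) := by
  rw [E2_slash_action]
  have hpi : (Real.pi : ℂ) ≠ 0 := Complex.ofReal_ne_zero.mpr Real.pi_ne_zero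
  simp only [Pi.sub_apply, Pi.smul_apply, smul_eq_mul, D2, riemannZeta_two]
  have hI := Complex.I_sq
  have hz := denom_ne_zero (γ : GL (Fin 2) ℝ) z
  field_simp
  linear_combination (-12 * (γ 1 0 : ℂ)) * hI

theorem mdiff_denom (γ : SL(2, ℤ)) : MDiff (fun z : ℍ ↦ (γ 1 0 : ℂ) / denom γ z) := by
  simp_rw [div_eq_mul_inv]
  exact mdifferentiable_const.mul (mdifferentiable_inv_denom _)

theorem normalizedDeriv_denom (γ : SL(2, ℤ)) (z : ℍ) :
    normalizedDerivOfComplex (fun z ↦ (γ 1 0 : ℂ) / denom γ z) z =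
      -(2 * Real.pi * Complex.I)⁻¹ * ((γ 1 0 : ℂ) / denom γ z) ^ 2 := by
  have h : HasDerivAt ((fun z : ℍ ↦ (γ 1 0 : ℂ) / denom γ z) ∘ ofComplex)
      ((γ 1 0 : ℂ) * (-1 * (γ 1 0 : ℂ) * (denom γ z) ^ (-1 - 1 : ℤ))) z := by
    have h1 := (hasDerivAt_denom_zpow (γ : GL (Fin 2) ℝ) (-1) z).const_mul (γ 1 0 : ℂ)
    refine HasDerivAt.congr_of_eventuallyEq (by simpa using h1) ?_
    filter_upwards [isOpen_upperHalfPlaneSet.mem_nhds z.im_pos] with w hw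
    simp [ofComplex_apply_of_im_pos hw, div_eq_mul_inv]
  rw [normalizedDerivOfComplex, h.deriv]
  have hz := denom_ne_zero (γ : GL (Fin 2) ℝ) z
  rw [show (-1 - 1 : ℤ) = -(2 : ℕ) by norm_num, zpow_neg, zpow_natCast]
  field_simp

/-- The non-modular terms in the transformation of E₂' and of E₂²/12 are equal, so they cancel in
the difference. -/
theorem sD_one_E2_mem : sD 1 E2 ∈ modForms 4 := by
  refine mem_modForms_of (mdiff_sD E2_mdifferentiable) (fun γ ↦ ?_)
    (isBoundedAtImInfty_sD E2_mdifferentiable isBoundedAtImInfty_E2)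
  have h1 := normalizedDerivOfComplex_SL_slash (k := 2) E2_mdifferentiable (γ := γ)
  set c : ℂ := (2 * Real.pi * Complex.I)⁻¹ with hc
  have h2 : E2 ∣[(2 : ℤ)] γ = E2 + (12 * c) • (fun z : ℍ ↦ (γ 1 0 : ℂ) / denom γ z) := by
    ext z
    rw [E2_slash_apply]
    simp only [Pi.add_apply, Pi.smul_apply, smul_eq_mul]
    ring
  have h3 : MDiff ((12 * c) • (fun z : ℍ ↦ (γ 1 0 : ℂ) / denom γ z)) :=
    (mdiff_denom γ).const_smul _
  rw [h2, normalizedDerivOfComplex_add _ _ E2_mdifferentiable h3,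
    normalizedDerivOfComplex_smul _ _ (mdiff_denom γ)] at h1
  ext z
  have h4 := congrFun h1 z
  have h5 := congrFun (ModularForm.mul_slash_SL2 2 2 γ E2 E2) z
  have h6 := congrFun h2 z
  simp only [Pi.add_apply, Pi.sub_apply, Pi.smul_apply, smul_eq_mul, normalizedDeriv_denom,
    Pi.mul_apply] at h4 h5 h6
  rw [h6] at h5
  have h7 : (sD 1 E2 ∣[(4 : ℤ)] γ) z = (normalizedDerivOfComplex E2 ∣[(2 + 2 : ℤ)] γ) z -
      12⁻¹ * ((E2 * E2) ∣[(2 + 2 : ℤ)] γ) z := by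
    rw [ModularForm.SL_slash_apply, ModularForm.SL_slash_apply, ModularForm.SL_slash_apply]
    simp [sD]
    ring
  rw [h7, h5]
  simp only [sD, serreDerivative_apply]
  push_cast at h4 ⊢
  linear_combination -h4

/-! ### The ring of modular forms as ℂ[E₄, E₆] -/

/-- The weights of `E₄` and `E₆`. -/
def wt : Fin 2 → ℤ := ![4, 6]

theorem weight_wt (d : Fin 2 →₀ ℕ) : Finsupp.weight wt d = 4 * d 0 + 6 * d 1 := by
  simp [Finsupp.weight_apply, Finsupp.sum_fintype, wt]
  ring

/-- Substitution of `E₄` and `E₆` into a polynomial. -/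
def ev : MvPolynomial (Fin 2) ℂ →ₐ[ℂ] (ℍ → ℂ) :=
  MvPolynomial.aeval ![(E₄ : ℍ → ℂ), (E₆ : ℍ → ℂ)]

theorem ev_apply (p : MvPolynomial (Fin 2) ℂ) (z : ℍ) :
    ev p z = MvPolynomial.eval ![E₄ z, E₆ z] p := by
  have h : (Pi.evalAlgHom ℂ (fun _ : ℍ ↦ ℂ) z).comp ev = MvPolynomial.aeval ![E₄ z, E₆ z] := by
    ext i
    fin_cases i <;> simp [ev]
  exact DFunLike.congr_fun h p

theorem ev_X_zero : ev (MvPolynomial.X 0) = E₄ := by simp [ev]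

theorem ev_X_one : ev (MvPolynomial.X 1) = E₆ := by simp [ev]

theorem ev_mem_modForms {k : ℤ} {p : MvPolynomial (Fin 2) ℂ} (hp : p.IsWeightedHomogeneous wt k) :
    ev p ∈ modForms k := by
  induction hp using MvPolynomial.IsWeightedHomogeneous.induction_on with
  | zero => simp
  | add p q _ _ hp hq =>
    rw [map_add]
    exact add_mem hp hq
  | monomial d r hr =>
    have h : ev (MvPolynomial.monomial d r) = r • ((E₄ : ℍ → ℂ) ^ d 0 * (E₆ : ℍ → ℂ) ^ d 1) := by
      ext z
      simp [ev_apply, MvPolynomial.eval_monomial, Finsupp.prod_fintype]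
    rw [h]
    refine Submodule.smul_mem _ _ ?_
    rw [← hr, weight_wt, mul_comm (4 : ℤ), mul_comm (6 : ℤ)]
    exact mul_mem_modForms (pow_mem_modForms (coe_mem_modForms E₄) _)
      (pow_mem_modForms (coe_mem_modForms E₆) _)

theorem exists_eq_discriminant_mul {k : ℤ} (F : ModularForm 𝒮ℒ k)
    (h : (qExpansion 1 F).coeff 0 = 0) :
    ∃ g ∈ modForms (k - 12), (F : ℍ → ℂ) = discriminant * g :=
  ⟨_, coe_mem_modForms (CuspForm.discriminantEquiv (toCuspForm F h)),
    (discriminant_mul_discriminantEquiv (toCuspForm F h)).symm⟩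

theorem exists_sub_smul_eq_discriminant_mul {k : ℤ} {f g : ℍ → ℂ} (hf : f ∈ modForms k)
    (hg : g ∈ modForms k) (h : (qExpansion 1 g).coeff 0 = 1) :
    ∃ c : ℂ, ∃ g' ∈ modForms (k - 12), f = c • g + discriminant * g' := by
  obtain ⟨F, rfl⟩ := hf
  obtain ⟨G, rfl⟩ := hg
  obtain ⟨g', hg', h'⟩ := exists_eq_discriminant_mul (F - (qExpansion 1 F).coeff 0 • G) (by
    rw [FunLike.coe_sub, FunLike.coe_smul,
      ← FunLike.coe_smul, ModularForm.qExpansion_sub one_pos one_mem_strictPeriods_SL,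
      FunLike.coe_smul, ModularForm.qExpansion_smul one_pos one_mem_strictPeriods_SL, map_sub,
      PowerSeries.coeff_smul, h, smul_eq_mul, mul_one, sub_self])
  refine ⟨(qExpansion 1 F).coeff 0, g', hg', ?_⟩
  rw [← h', FunLike.coe_sub, FunLike.coe_smul]
  abel

theorem coeff_zero_qExpansion_E₄_pow_mul_E₆_pow (a b : ℕ) :
    (qExpansion 1 ((E₄ : ℍ → ℂ) ^ a * (E₆ : ℍ → ℂ) ^ b)).coeff 0 = 1 := by
  rw [← coe_pow, ← coe_pow, ModularForm.qExpansion_mul_coe one_pos one_mem_strictPeriods_SL,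
    ModularForm.qExpansion_pow one_pos one_mem_strictPeriods_SL,
    ModularForm.qExpansion_pow one_pos one_mem_strictPeriods_SL]
  have h4 := E_qExpansion_coeff_zero (k := 4) (by norm_num) ⟨2, rfl⟩
  have h6 := E_qExpansion_coeff_zero (k := 6) (by norm_num) ⟨3, rfl⟩
  rw [PowerSeries.coeff_zero_eq_constantCoeff] at *
  rw [map_mul, map_pow, map_pow, h4, h6]
  simp

theorem exists_ev_eq_discriminant :
    ∃ p : MvPolynomial (Fin 2) ℂ, p.IsWeightedHomogeneous wt 12 ∧ ev p = discriminant := by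
  refine ⟨MvPolynomial.C (1728⁻¹ : ℂ) * (MvPolynomial.X 0 ^ 3 - MvPolynomial.X 1 ^ 2), ?_, ?_⟩
  · refine MvPolynomial.IsWeightedHomogeneous.C_mul (.sub ?_ ?_) _
    · exact (MvPolynomial.isWeightedHomogeneous_X ℂ wt 0).pow 3
    · exact (MvPolynomial.isWeightedHomogeneous_X ℂ wt 1).pow 2
  · ext z
    rw [discriminant_eq_E₄_cube_sub_E₆_sq, ev_apply]
    simp
    ring

/-- Induction on a bound for the weight: subtracting a multiple of a monomial E₄ᵃE₆ᵇ kills the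
constant term, and dividing by the discriminant lowers the weight by 12. Such a monomial exists in
every even weight `k ≥ 0` except 2. -/
theorem exists_ev_eq {k : ℤ} {f : ℍ → ℂ} (hf : f ∈ modForms k) :
    ∃ p : MvPolynomial (Fin 2) ℂ, p.IsWeightedHomogeneous wt k ∧ ev p = f := by
  suffices H : ∀ n : ℕ, ∀ k : ℤ, k < n → ∀ f ∈ modForms k,
      ∃ p : MvPolynomial (Fin 2) ℂ, p.IsWeightedHomogeneous wt k ∧ ev p = f from
    H (k.toNat + 1) k (by lia) f hf
  intro n
  induction n with
  | zero =>
    rintro k hk _ ⟨F, rfl⟩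
    exact ⟨0, MvPolynomial.isWeightedHomogeneous_zero _ _ _,
      by rw [map_zero, ModularFormClass.levelOne_neg_weight_eq_zero (by simpa using hk) F]⟩
  | succ n ih =>
    intro k hk f hf
    have hzero : ∀ f : ℍ → ℂ, f = 0 →
        ∃ p : MvPolynomial (Fin 2) ℂ, p.IsWeightedHomogeneous wt k ∧ ev p = f := by
      rintro f rfl
      exact ⟨0, MvPolynomial.isWeightedHomogeneous_zero _ _ _, map_zero _⟩
    rcases lt_or_ge k 0 with hneg | hpos
    · obtain ⟨F, rfl⟩ := hf
      exact hzero _ (ModularFormClass.levelOne_neg_weight_eq_zero hneg F)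
    rcases Int.even_or_odd k with heven | hodd
    swap
    · obtain ⟨F, rfl⟩ := hf
      refine hzero _ ?_
      rw [levelOne_odd_weight_eq_zero hodd F]
      rfl
    by_cases h2 : k = 2
    · subst h2
      obtain ⟨F, rfl⟩ := hf
      refine hzero _ ?_
      rw [rank_zero_iff_forall_zero.mp levelOne_weight_two_rank_zero F]
      rfl
    obtain ⟨a, b, hab⟩ : ∃ a b : ℕ, (a : ℤ) * 4 + b * 6 = k := by
      obtain ⟨m, rfl⟩ := heven
      rcases Int.even_or_odd m with ⟨j, rfl⟩ | ⟨j, rfl⟩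
      · exact ⟨j.toNat, 0, by lia⟩
      · exact ⟨(j - 1).toNat, 1, by lia⟩
    obtain ⟨c, g, hg, rfl⟩ := exists_sub_smul_eq_discriminant_mul hf
      (hab ▸ mul_mem_modForms (pow_mem_modForms (coe_mem_modForms E₄) a)
        (pow_mem_modForms (coe_mem_modForms E₆) b))
      (coeff_zero_qExpansion_E₄_pow_mul_E₆_pow a b)
    obtain ⟨p, hp, rfl⟩ := ih (k - 12) (by lia) g hg
    obtain ⟨q, hq, hq'⟩ := exists_ev_eq_discriminant
    refine ⟨MvPolynomial.C c * (MvPolynomial.X 0 ^ a * MvPolynomial.X 1 ^ b) + q * p, ?_, ?_⟩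
    · refine .add (.C_mul ?_ _) ?_
      · rw [← hab]
        have h4 := (MvPolynomial.isWeightedHomogeneous_X ℂ wt 0).pow a
        have h6 := (MvPolynomial.isWeightedHomogeneous_X ℂ wt 1).pow b
        simpa [wt] using h4.mul h6
      · simpa using hq.mul hp
    · rw [map_add, map_mul, map_mul, map_mul, map_pow, map_pow, ev_X_zero, ev_X_one, hq',
        ← MvPolynomial.algebraMap_eq, AlgHom.commutes, Algebra.smul_def]

theorem E₆_I : E₆ (UpperHalfPlane.I) = 0 := by
  have h := congrFun (slash_of_mem_modForms (coe_mem_modForms E₆) ModularGroup.S) UpperHalfPlane.I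
  rw [ModularForm.SL_slash_apply] at h
  have h1 : ModularGroup.S • UpperHalfPlane.I = UpperHalfPlane.I := by
    rw [UpperHalfPlane.modular_S_smul]
    ext
    simp
  rw [h1, ModularGroup.denom_S] at h
  have h2 : ((UpperHalfPlane.I : ℍ) : ℂ) ^ (-6 : ℤ) = -1 := by
    rw [UpperHalfPlane.coe_I, zpow_neg, show (6 : ℤ) = (6 : ℕ) from rfl, zpow_natCast,
      show (6 : ℕ) = 2 * 3 from rfl, pow_mul, Complex.I_sq]
    norm_num
  rw [h2] at h
  linear_combination -(1 / 2 : ℂ) * h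

theorem E₄_I_ne_zero : E₄ (UpperHalfPlane.I) ≠ 0 := by
  intro h
  apply discriminant_ne_zero UpperHalfPlane.I
  rw [discriminant_eq_E₄_cube_sub_E₆_sq, h, E₆_I]
  norm_num

/-- At the point i, E₆ vanishes and E₄ does not. By homogeneity at most one monomial of `p` is free
of E₆, so its coefficient is zero; E₆ then divides `p` and can be cancelled, lowering the weight by
6. -/
theorem eq_zero_of_ev_eq_zero {k : ℤ} {p : MvPolynomial (Fin 2) ℂ}
    (hp : p.IsWeightedHomogeneous wt k) (h : ev p = 0) : p = 0 := by
  suffices H : ∀ n : ℕ, ∀ k : ℤ, k < n → ∀ p : MvPolynomial (Fin 2) ℂ,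
      p.IsWeightedHomogeneous wt k → ev p = 0 → p = 0 from H (k.toNat + 1) k (by lia) p hp h
  intro n
  induction n with
  | zero =>
    intro k hk p hp _
    ext d
    by_contra hd
    have := hp hd
    rw [weight_wt] at this
    lia
  | succ n ih =>
    intro k hk p hp h
    have hcoeff : ∀ d : Fin 2 →₀ ℕ, d 1 = 0 → p.coeff d = 0 := by
      intro d hd
      by_contra hne
      have hw := hp hne
      have hI := congrFun h UpperHalfPlane.I
      rw [ev_apply, MvPolynomial.eval_eq', Finset.sum_eq_single d] at hI
      · simp [Fin.prod_univ_two, hd, E₄_I_ne_zero, hne] at hI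
      · intro e he hed
        have hw' := hp (MvPolynomial.mem_support_iff.mp he)
        have : e 1 ≠ 0 := by
          intro he1
          apply hed
          rw [weight_wt] at hw hw'
          ext i
          fin_cases i
          · simp only [Fin.zero_eta]
            lia
          · simp [he1, hd]
        simp [Fin.prod_univ_two, E₆_I, this]
      · intro hd'
        simp [MvPolynomial.notMem_support_iff.mp hd']
    have hdvd : MvPolynomial.X 1 ∣ p := by
      rw [MvPolynomial.X_dvd_iff_modMonomial_eq_zero]
      ext d
      by_cases hd : d 1 = 0
      · rw [MvPolynomial.coeff_modMonomial_of_not_le, hcoeff d hd, MvPolynomial.coeff_zero]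
        rw [Finsupp.single_le_iff]
        lia
      · rw [MvPolynomial.coeff_modMonomial_of_le, MvPolynomial.coeff_zero]
        rw [Finsupp.single_le_iff]
        lia
    obtain ⟨q, rfl⟩ := hdvd
    have hq : q.IsWeightedHomogeneous wt (k - 6) := by
      intro d hd
      have := hp (d := Finsupp.single 1 1 + d) (by rwa [MvPolynomial.coeff_X_mul])
      rw [weight_wt] at this ⊢
      simp at this
      lia
    have hq0 : ev q = 0 := by
      rw [map_mul, ev_X_one] at h
      refine ((UpperHalfPlane.mul_eq_zero_iff E₆.holo'
        (mdiff_of_mem_modForms (ev_mem_modForms hq))).mp h).resolve_left fun h6 ↦ E_ne_zero (k := 6) (by norm_num) ⟨3, rfl⟩ ?_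
      exact DFunLike.coe_injective h6
    rw [ih _ (by lia) q hq hq0, mul_zero]

/-! ### Independence of E₂ over modular forms -/

/-- The form `E₂` is algebraically independent of the modular forms. -/
theorem modForms_E2_independent {N : ℕ} {k : ℤ} {a : ℕ → ℍ → ℂ}
    (ha : ∀ i < N, a i ∈ modForms (k - 2 * i)) (h : ∑ i ∈ Finset.range N, a i * E2 ^ i = 0) :
    ∀ i < N, a i = 0 := by
  intro i hi
  ext z
  let P : Polynomial ℂ := ∑ i ∈ Finset.range N, Polynomial.C (a i z) * Polynomial.X ^ i
  -- The relation at `γ • z`, multiplied by `denom γ z ^ (-k)`, keeps the coefficients `a i z` and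
  -- replaces `E2 z` by its slash. One polynomial thus has a root for each `γ`.
  have hroot : ∀ γ : SL(2, ℤ), P.IsRoot ((E2 ∣[(2 : ℤ)] γ) z) := by
    intro γ
    have h1 := congrFun h (γ • z)
    have hz := denom_ne_zero (γ : GL (Fin 2) ℝ) z
    simp only [P, Polynomial.IsRoot, Polynomial.eval_finsetSum, Polynomial.eval_mul,
      Polynomial.eval_C, Polynomial.eval_pow, Polynomial.eval_X]
    rw [Finset.sum_apply] at h1
    have h2 : ∀ i ∈ Finset.range N, a i z * ((E2 ∣[(2 : ℤ)] γ) z) ^ i =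
        (a i * E2 ^ i) (γ • z) * (denom γ z) ^ (-k) := by
      intro i hi
      have h3 := congrFun (slash_of_mem_modForms (ha i (Finset.mem_range.mp hi)) γ) z
      rw [← h3, ModularForm.SL_slash_apply, ModularForm.SL_slash_apply, mul_pow,
        ← zpow_natCast (denom γ z ^ (-2 : ℤ)), ← zpow_mul, Pi.mul_apply, Pi.pow_apply,
        show -k = -(k - 2 * i) + -2 * i by ring, zpow_add₀ hz]
      ring
    rw [Finset.sum_congr rfl h2, ← Finset.sum_mul, h1]
    simp
  have hinf : Set.Infinite {x | P.IsRoot x} := by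
    -- For these matrices the correction to `E2 z` is a multiple of n/(nz + 1), which is injective
    -- in n.
    let γ : ℤ → SL(2, ℤ) := fun n ↦ ⟨!![1, 0; n, 1], by simp⟩
    refine Set.infinite_of_injective_forall_mem (f := fun n : ℤ ↦ (E2 ∣[(2 : ℤ)] γ n) z) ?_
      (fun n ↦ hroot (γ n))
    intro m n hmn
    simp only [E2_slash_apply] at hmn
    have hpi : (2 * Real.pi * Complex.I : ℂ)⁻¹ ≠ 0 := inv_ne_zero Complex.two_pi_I_ne_zero
    have hm := denom_ne_zero (γ m : GL (Fin 2) ℝ) z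
    have hn := denom_ne_zero (γ n : GL (Fin 2) ℝ) z
    have h1 : ((γ m) 1 0 : ℂ) / denom (γ m) z = (γ n) 1 0 / denom (γ n) z := by
      have := add_left_cancel hmn
      exact mul_left_cancel₀ hpi (mul_left_cancel₀ (by norm_num) this)
    rw [div_eq_div_iff hm hn, ModularGroup.denom_apply, ModularGroup.denom_apply] at h1
    simp [γ] at h1
    have h2 : (m : ℂ) = n := by linear_combination h1
    exact_mod_cast h2
  have hP : P = 0 := Polynomial.eq_zero_of_infinite_isRoot P hinf
  have := congrArg (fun P ↦ Polynomial.coeff P i) hP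
  simpa [P, Polynomial.finsetSum_coeff, Polynomial.coeff_C_mul, Polynomial.coeff_X_pow, hi]
    using this

/-! ### Graded modules stable under Serre derivatives -/

section GradedSpan

variable {ι : Type} [Fintype ι]

/-- The functions of weight `k` in the graded module over the ring of level one modular forms
generated by functions `u i` of weights `w i`. -/
def gradedSpan (u : ι → ℍ → ℂ) (w : ι → ℤ) (k : ℤ) : Submodule ℂ (ℍ → ℂ) where
  carrier := {f | ∃ c : ι → ℍ → ℂ, (∀ i, c i ∈ modForms (k - w i)) ∧ ∑ i, c i * u i = f}
  add_mem' := by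
    rintro _ _ ⟨c, hc, rfl⟩ ⟨d, hd, rfl⟩
    exact ⟨c + d, fun i ↦ add_mem (hc i) (hd i), by
      simp [add_mul, Finset.sum_add_distrib]⟩
  zero_mem' := ⟨0, fun i ↦ zero_mem _, by simp⟩
  smul_mem' := by
    rintro a _ ⟨c, hc, rfl⟩
    exact ⟨a • c, fun i ↦ Submodule.smul_mem _ _ (hc i), by
      simp [Finset.smul_sum]⟩

variable {u : ι → ℍ → ℂ} {w : ι → ℤ} {k l : ℤ} {f g : ℍ → ℂ}

theorem mul_mem_gradedSpan (hg : g ∈ modForms l) (hf : f ∈ gradedSpan u w k) :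
    g * f ∈ gradedSpan u w (l + k) := by
  obtain ⟨c, hc, rfl⟩ := hf
  refine ⟨fun i ↦ g * c i, fun i ↦ ?_, ?_⟩
  · rw [add_sub_assoc]
    exact mul_mem_modForms hg (hc i)
  · simp [Finset.mul_sum, mul_assoc]

theorem generator_mem_gradedSpan (i : ι) : u i ∈ gradedSpan u w (w i) := by
  classical
  refine ⟨Pi.single i 1, fun j ↦ ?_, ?_⟩
  · by_cases h : j = i
    · subst h
      simpa using one_mem_modForms
    · simp [h]
  · rw [Finset.sum_eq_single i]
    · simp
    · intro j _ hj
      simp [hj]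
    · simp

/-- A graded module over the ring of modular forms that is stable under Serre derivatives. -/
structure IsDClosed (u : ι → ℍ → ℂ) (w : ι → ℤ) : Prop where
  mdiff : ∀ i, MDiff (u i)
  sD_mem : ∀ i, sD (w i) (u i) ∈ gradedSpan u w (w i + 2)

theorem IsDClosed.mdiff_and_sD_mem (h : IsDClosed u w) (hf : f ∈ gradedSpan u w k) :
    MDiff f ∧ sD k f ∈ gradedSpan u w (k + 2) := by
  obtain ⟨c, hc, rfl⟩ := hf
  refine Finset.sum_induction _ (fun f : ℍ → ℂ ↦ MDiff f ∧ sD k f ∈ gradedSpan u w (k + 2)) ?_ ?_ ?_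
  · rintro f g ⟨hf, hf'⟩ ⟨hg, hg'⟩
    refine ⟨MDifferentiable.add hf hg, ?_⟩
    rw [sD_add hf hg]
    exact add_mem hf' hg'
  · refine ⟨mdifferentiable_const, ?_⟩
    rw [sD_zero]
    exact zero_mem _
  · intro i _
    have hci := mdiff_of_mem_modForms (hc i)
    refine ⟨hci.mul (h.mdiff i), ?_⟩
    have := sD_mul (k := k - w i) (l := w i) hci (h.mdiff i)
    rw [sub_add_cancel] at this
    rw [this]
    refine add_mem ?_ ?_
    · have := mul_mem_gradedSpan (sD_mem_modForms (hc i))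
        (generator_mem_gradedSpan (u := u) (w := w) i)
      rwa [show k - w i + 2 + w i = k + 2 by ring] at this
    · have := mul_mem_gradedSpan (hc i) (h.sD_mem i)
      rwa [show k - w i + (w i + 2) = k + 2 by ring] at this

/-- The shift `d` allows the same functions to be regraded, as needed to pass from weight `k` to
weight `k - s`. -/
theorem gradedSpan_le {κ : Type} [Fintype κ] {v : κ → ℍ → ℂ} {x : κ → ℤ} {d : ℤ}
    (h : ∀ i, u i ∈ gradedSpan v x (w i + d)) (hf : f ∈ gradedSpan u w k) :
    f ∈ gradedSpan v x (k + d) := by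
  obtain ⟨c, hc, rfl⟩ := hf
  refine sum_mem fun i _ ↦ ?_
  have := mul_mem_gradedSpan (hc i) (h i)
  rwa [show k - w i + (w i + d) = k + d by ring] at this

end GradedSpan

/-! ### Monic MLDEs and finitely generated stable modules -/

theorem iterSerre_succ (k : ℤ) (n : ℕ) (f : ℍ → ℂ) :
    iterSerre (k : ℝ) (n + 1) f = sD (k + 2 * n) (iterSerre (k : ℝ) n f) := by
  rw [iterSerre, sD]
  push_cast
  rfl

theorem mdiff_iterSerre (k : ℤ) (n : ℕ) {f : ℍ → ℂ} (hf : MDiff f) :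
    MDiff (iterSerre (k : ℝ) n f) := by
  induction n with
  | zero => exact hf
  | succ n ih =>
    rw [iterSerre_succ]
    exact mdiff_sD ih

theorem solvesMonicMLDE_iff {k : ℝ} {n : ℕ} {f : ℍ → ℂ} :
    SolvesMonicMLDE k n f ↔ ∃ g : ℕ → ℍ → ℂ, (∀ i : ℕ, g i ∈ modForms (2 * (i : ℤ))) ∧
      iterSerre k n f + ∑ i ∈ Finset.Icc 1 n, g i * iterSerre k (n - i) f = 0 := by
  constructor
  · rintro ⟨g, hg⟩
    refine ⟨fun i ↦ g i, fun i ↦ coe_mem_modForms _, ?_⟩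
    ext z
    simpa using hg z
  · rintro ⟨g, hg, h⟩
    choose G hG using hg
    refine ⟨G, fun z ↦ ?_⟩
    have := congrFun h z
    simpa [hG] using this

/-- The increasing chain of spans of initial segments stabilizes. -/
theorem exists_mem_span_image_lt {R V : Type*} [CommRing R] [IsNoetherianRing R] [AddCommGroup V]
    [Module R V] [Module.Finite R V] (v : ℕ → V) :
    ∃ n, v n ∈ Submodule.span R (v '' (Finset.range n : Set ℕ)) := by
  let N : ℕ →o Submodule R V := ⟨fun n ↦ Submodule.span R (v '' (Finset.range n : Set ℕ)),
    fun m n hmn ↦ Submodule.span_mono (Set.image_mono (by simpa using hmn))⟩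
  obtain ⟨n, hn⟩ := monotone_stabilizes_iff_noetherian.mpr (inferInstance : IsNoetherian R V) N
  refine ⟨n, ?_⟩
  have h := hn (n + 1) (Nat.le_succ n)
  change _ ∈ N n
  rw [h]
  exact Submodule.subset_span ⟨n, by simp, rfl⟩

theorem weightedHomogeneousComponent_add_mul {σ : Type*} {w : σ → ℤ} (p : MvPolynomial σ ℂ) (m : ℤ)
    {n : ℤ} {q : MvPolynomial σ ℂ} (hq : q.IsWeightedHomogeneous w n) :
    MvPolynomial.weightedHomogeneousComponent w (m + n) (p * q) =
      MvPolynomial.weightedHomogeneousComponent w m p * q := by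
  let := MvPolynomial.weightedGradedAlgebra ℂ w
  have h := DirectSum.coe_decompose_mul_add_of_right_mem
    (MvPolynomial.weightedHomogeneousSubmodule ℂ w) (i := m) (a := p) hq
  have hd : ∀ (p : MvPolynomial σ ℂ) (i : ℤ),
      (DirectSum.decompose (MvPolynomial.weightedHomogeneousSubmodule ℂ w) p i :
        MvPolynomial σ ℂ) = MvPolynomial.weightedHomogeneousComponent w i p :=
    MvPolynomial.weightedDecomposition.decompose'_apply ℂ w
  rwa [hd, hd] at h

theorem mem_SigmaSet_of_mem_gradedSpan {ι : Type} [Fintype ι] {u : ι → ℍ → ℂ} {w : ι → ℤ}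
    (hu : IsDClosed u w) {k : ℤ} {f : ℍ → ℂ} (hf : f ∈ gradedSpan u w k) :
    f ∈ SigmaSet (k : ℝ) := by
  refine ⟨(hu.mdiff_and_sD_mem hf).1, ?_⟩
  have hmem : ∀ n : ℕ, iterSerre (k : ℝ) n f ∈ gradedSpan u w (k + 2 * n) := by
    intro n
    induction n with
    | zero => simpa [iterSerre] using hf
    | succ n ih =>
      rw [iterSerre_succ]
      have := (hu.mdiff_and_sD_mem ih).2
      rwa [show k + 2 * n + 2 = k + 2 * (n + 1 : ℕ) by push_cast; ring] at this
  choose c hc hcf using hmem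
  choose v hv hvc using fun n i ↦ exists_ev_eq (hc n i)
  obtain ⟨n, hn⟩ := exists_mem_span_image_lt (R := MvPolynomial (Fin 2) ℂ) v
  rw [Submodule.mem_span_image_finset_iff_exists_fun'] at hn
  obtain ⟨r, hr⟩ := hn
  -- The relation `hr` need not be homogeneous. Only the part of `r j` of weight `2 * (n - j)`
  -- contributes to the weight `k + 2 * n` of the `n`-th derivative.
  let q : ℕ → MvPolynomial (Fin 2) ℂ := fun j ↦
    MvPolynomial.weightedHomogeneousComponent wt (2 * (n - j : ℤ)) (r j)
  have hq : ∀ j, (q j).IsWeightedHomogeneous wt (2 * (n - j : ℤ)) := fun j ↦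
    MvPolynomial.weightedHomogeneousComponent_isWeightedHomogeneous _ _
  have hqv : ∀ i, ∑ j ∈ Finset.range n, q j * v j i = v n i := by
    intro i
    have h1 := congrFun hr i
    have h2 := congrArg
      (MvPolynomial.weightedHomogeneousComponent wt (k + 2 * n - w i)) h1
    rw [MvPolynomial.weightedHomogeneousComponent_eq_self (hv n i), Finset.sum_apply,
      map_sum] at h2
    rw [← h2]
    refine Finset.sum_congr rfl fun j _ ↦ ?_
    have h3 := weightedHomogeneousComponent_add_mul (r j) (2 * (n - j : ℤ)) (hv j i)
    rw [show 2 * (n - j : ℤ) + (k + 2 * j - w i) = k + 2 * n - w i by ring] at h3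
    exact h3.symm
  -- The truncated `n - i` gives the right weight only for `i ≤ n`, hence the default value 0
  -- beyond.
  refine ⟨n, solvesMonicMLDE_iff.mpr ⟨fun i ↦ if i ≤ n then -ev (q (n - i)) else 0,
    fun i ↦ ?_, ?_⟩⟩
  · dsimp only
    split_ifs with hi
    · refine neg_mem ?_
      have := ev_mem_modForms (hq (n - i))
      rwa [show (2 * (n - (n - i : ℕ) : ℤ)) = 2 * i by lia] at this
    · exact zero_mem _
  · have h1 : ∑ i ∈ Finset.Icc 1 n, (if i ≤ n then -ev (q (n - i)) else 0) *
        iterSerre (k : ℝ) (n - i) f =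
        -∑ j ∈ Finset.range n, ev (q j) * iterSerre (k : ℝ) j f := by
      rw [← Finset.sum_neg_distrib]
      refine Finset.sum_bij' (fun i _ ↦ n - i) (fun j _ ↦ n - j) ?_ ?_ ?_ ?_ ?_
      · intro i hi
        simp at hi ⊢
        lia
      · intro i hi
        simp at hi ⊢
        lia
      · intro i hi
        simp at hi
        lia
      · intro i hi
        simp at hi
        lia
      · intro i hi
        rw [if_pos (Finset.mem_Icc.mp hi).2, neg_mul]
    rw [h1, ← sub_eq_add_neg, sub_eq_zero]
    rw [← hcf n]
    simp_rw [← hvc, ← hqv, map_sum, map_mul, hvc, Finset.sum_mul, mul_assoc]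
    rw [Finset.sum_comm]
    refine Finset.sum_congr rfl fun j _ ↦ ?_
    rw [← Finset.mul_sum, hcf]

theorem exists_isDClosed_of_mem_SigmaSet {k : ℤ} {f : ℍ → ℂ} (hf : f ∈ SigmaSet (k : ℝ)) :
    ∃ (n : ℕ) (u : Fin n → ℍ → ℂ) (w : Fin n → ℤ), IsDClosed u w ∧ f ∈ gradedSpan u w k := by
  obtain ⟨hd, n, hn⟩ := hf
  obtain ⟨g, hg, h⟩ := solvesMonicMLDE_iff.mp hn
  let u : Fin n → ℍ → ℂ := fun i ↦ iterSerre (k : ℝ) i f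
  let w : Fin n → ℤ := fun i ↦ k + 2 * i
  have hmem : ∀ m < n, iterSerre (k : ℝ) m f ∈ gradedSpan u w (k + 2 * m) := fun m hm ↦
    generator_mem_gradedSpan (u := u) (w := w) ⟨m, hm⟩
  have hlast : iterSerre (k : ℝ) n f ∈ gradedSpan u w (k + 2 * n) := by
    rw [eq_neg_of_add_eq_zero_left h]
    refine neg_mem (sum_mem fun i hi ↦ ?_)
    rw [Finset.mem_Icc] at hi
    have := mul_mem_gradedSpan (hg i) (hmem (n - i) (by lia))
    rwa [show 2 * i + (k + 2 * (n - i : ℕ)) = k + 2 * n by lia] at this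
  have hall : ∀ m ≤ n, iterSerre (k : ℝ) m f ∈ gradedSpan u w (k + 2 * m) := fun m hm ↦ by
    rcases hm.lt_or_eq with hm | rfl
    · exact hmem m hm
    · exact hlast
  refine ⟨n, u, w, ⟨fun i ↦ mdiff_iterSerre _ _ hd, fun i ↦ ?_⟩, ?_⟩
  · have := hall (i + 1) i.2
    rw [iterSerre_succ] at this
    rwa [show k + 2 * (i + 1 : ℕ) = w i + 2 by simp [w]; ring] at this
  · simpa [iterSerre] using hall 0 (Nat.zero_le n)

/-! ### Sums and products of solutions -/

theorem add_mem_SigmaSet {k : ℤ} {f g : ℍ → ℂ} (hf : f ∈ SigmaSet (k : ℝ))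
    (hg : g ∈ SigmaSet (k : ℝ)) : f + g ∈ SigmaSet (k : ℝ) := by
  obtain ⟨m, u, w, hu, hfu⟩ := exists_isDClosed_of_mem_SigmaSet hf
  obtain ⟨n, v, x, hv, hgv⟩ := exists_isDClosed_of_mem_SigmaSet hg
  have hl : ∀ {l : ℤ} {f}, f ∈ gradedSpan u w l → f ∈ gradedSpan (Sum.elim u v) (Sum.elim w x) l :=
    fun {l f} hf ↦ by
      rw [← add_zero l]
      refine gradedSpan_le (fun i ↦ ?_) hf
      rw [add_zero]
      exact generator_mem_gradedSpan (u := Sum.elim u v) (w := Sum.elim w x) (Sum.inl i)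
  have hr : ∀ {l : ℤ} {f}, f ∈ gradedSpan v x l → f ∈ gradedSpan (Sum.elim u v) (Sum.elim w x) l :=
    fun {l f} hf ↦ by
      rw [← add_zero l]
      refine gradedSpan_le (fun i ↦ ?_) hf
      rw [add_zero]
      exact generator_mem_gradedSpan (u := Sum.elim u v) (w := Sum.elim w x) (Sum.inr i)
  refine mem_SigmaSet_of_mem_gradedSpan (u := Sum.elim u v) (w := Sum.elim w x) ⟨?_, ?_⟩
    (add_mem (hl hfu) (hr hgv))
  · rintro (i | i)
    · exact hu.mdiff i
    · exact hv.mdiff i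
  · rintro (i | i)
    · exact hl (hu.sD_mem i)
    · exact hr (hv.sD_mem i)

theorem neg_mem_SigmaSet {k : ℤ} {f : ℍ → ℂ} (hf : f ∈ SigmaSet (k : ℝ)) :
    -f ∈ SigmaSet (k : ℝ) := by
  obtain ⟨m, u, w, hu, hfu⟩ := exists_isDClosed_of_mem_SigmaSet hf
  exact mem_SigmaSet_of_mem_gradedSpan hu (neg_mem hfu)

theorem mul_mem_SigmaSet {k l : ℤ} {f g : ℍ → ℂ} (hf : f ∈ SigmaSet (k : ℝ))
    (hg : g ∈ SigmaSet (l : ℝ)) : f * g ∈ SigmaSet ((k + l : ℤ) : ℝ) := by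
  obtain ⟨m, u, w, hu, hfu⟩ := exists_isDClosed_of_mem_SigmaSet hf
  obtain ⟨n, v, x, hv, hgv⟩ := exists_isDClosed_of_mem_SigmaSet hg
  let y : Fin m × Fin n → ℍ → ℂ := fun i ↦ u i.1 * v i.2
  let t : Fin m × Fin n → ℤ := fun i ↦ w i.1 + x i.2
  have hmul : ∀ {k l : ℤ} {f g : ℍ → ℂ}, f ∈ gradedSpan u w k → g ∈ gradedSpan v x l →
      f * g ∈ gradedSpan y t (k + l) := by
    rintro k l _ _ ⟨c, hc, rfl⟩ ⟨d, hd, rfl⟩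
    rw [Finset.sum_mul_sum]
    refine sum_mem fun i _ ↦ sum_mem fun j _ ↦ ?_
    have := mul_mem_gradedSpan (mul_mem_modForms (hc i) (hd j))
      (generator_mem_gradedSpan (u := y) (w := t) (i, j))
    rw [show k - w i + (l - x j) + t (i, j) = k + l by simp only [t]; ring] at this
    rwa [show c i * u i * (d j * v j) = c i * d j * y (i, j) by simp only [y]; ring]
  refine mem_SigmaSet_of_mem_gradedSpan (u := y) (w := t) ⟨fun i ↦ ?_, fun i ↦ ?_⟩ (hmul hfu hgv)
  · exact (hu.mdiff i.1).mul (hv.mdiff i.2)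
  · simp only [y, t]
    rw [sD_mul (hu.mdiff i.1) (hv.mdiff i.2)]
    refine add_mem ?_ ?_
    · have := hmul (hu.sD_mem i.1) (generator_mem_gradedSpan (u := v) (w := x) i.2)
      rwa [show w i.1 + 2 + x i.2 = w i.1 + x i.2 + 2 by ring] at this
    · have := hmul (generator_mem_gradedSpan (u := u) (w := w) i.1) (hv.sD_mem i.2)
      rwa [← add_assoc] at this

/-! ### Powers of E₂ and monotonicity in the weight -/

theorem sD_E2_pow (k : ℤ) (i : ℕ) :
    sD k (E2 ^ (i + 1)) = (((i + 1 : ℂ)) • (sD 1 E2 * E2 ^ i)) +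
      (((i + 1 : ℂ) - k) * 12⁻¹) • E2 ^ (i + 2) := by
  rw [sD_eq, sD_eq, normalizedDerivOfComplex_pow _ _ E2_mdifferentiable]
  ext z
  simp
  ring

/-- In weight w, the coefficient of `E2 ^ (i + 1)` in the Serre derivative of `E2 ^ i` is (i -
w)/12. For w = 2i - s this is (s - i)/12, which vanishes at i = s, so the derivative never leaves
the span. -/
theorem isDClosed_E2_pow (s : ℕ) :
    IsDClosed (fun i : Fin (s + 1) ↦ E2 ^ (i : ℕ)) (fun i ↦ 2 * (i : ℤ) - s) := by
  have hpow : ∀ n : ℕ, MDiff (E2 ^ n) := by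
    intro n
    induction n with
    | zero => exact mdifferentiable_const
    | succ n ih =>
      rw [pow_succ]
      exact ih.mul E2_mdifferentiable
  refine ⟨fun i ↦ hpow i, fun i ↦ ?_⟩
  set u := (fun i : Fin (s + 1) ↦ E2 ^ (i : ℕ)) with hu
  set w := (fun i : Fin (s + 1) ↦ 2 * (i : ℤ) - s) with hw
  have hgen : ∀ j ≤ s, E2 ^ j ∈ gradedSpan u w (2 * j - s) := fun j hj ↦
    generator_mem_gradedSpan (u := u) (w := w) ⟨j, by lia⟩
  have hnext : (((i : ℂ) - w i) * 12⁻¹) • E2 ^ ((i : ℕ) + 1) ∈ gradedSpan u w (w i + 2) := by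
    rcases (Nat.lt_succ_iff.mp i.2).lt_or_eq with hi | hi
    · refine Submodule.smul_mem _ _ ?_
      have := hgen (i + 1) hi
      rwa [show 2 * ((i : ℕ) + 1 : ℕ) - s = w i + 2 by simp only [hw]; lia] at this
    · have : ((i : ℂ) - w i) = 0 := by
        simp only [hw]
        rw [hi]
        push_cast
        ring
      rw [this]
      simp
  obtain ⟨i, hi⟩ := i
  cases i with
  | zero =>
    have h : sD (w ⟨0, hi⟩) (u ⟨0, hi⟩) = (((0 : ℂ) - w ⟨0, hi⟩) * 12⁻¹) • E2 ^ 1 := by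
      rw [sD_eq]
      have : normalizedDerivOfComplex (u ⟨0, hi⟩) = 0 := normalizedDerivOfComplex_const 1
      rw [this]
      ext z
      simp [hu]
    change sD (w ⟨0, hi⟩) (u ⟨0, hi⟩) ∈ gradedSpan u w (w ⟨0, hi⟩ + 2)
    rw [h]
    simpa only [Nat.cast_zero, zero_add] using hnext
  | succ i =>
    have h := sD_E2_pow (w ⟨i + 1, hi⟩) i
    change sD (w ⟨i + 1, hi⟩) (E2 ^ (i + 1)) ∈ gradedSpan u w (w ⟨i + 1, hi⟩ + 2)
    rw [h]
    refine add_mem (Submodule.smul_mem _ _ ?_) ?_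
    · have := mul_mem_gradedSpan sD_one_E2_mem (hgen i (by lia))
      rwa [show 4 + (2 * i - s) = w ⟨i + 1, hi⟩ + 2 by simp only [hw]; push_cast; ring] at this
    · simpa only [Nat.cast_add, Nat.cast_one, add_assoc] using hnext

theorem one_mem_SigmaSet : (1 : ℍ → ℂ) ∈ SigmaSet ((-1 : ℤ) : ℝ) := by
  have := generator_mem_gradedSpan (u := fun i : Fin (1 + 1) ↦ E2 ^ (i : ℕ))
    (w := fun i ↦ 2 * (i : ℤ) - (1 : ℕ)) 0
  exact mem_SigmaSet_of_mem_gradedSpan (isDClosed_E2_pow 1) (by simpa using this)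

theorem SigmaSet_antitone {k l : ℤ} (h : k ≤ l) : SigmaSet (l : ℝ) ⊆ SigmaSet (k : ℝ) := by
  intro f hf
  suffices H : ∀ n : ℕ, f ∈ SigmaSet ((l - n : ℤ) : ℝ) by
    have := H (l - k).toNat
    rwa [show l - (l - k).toNat = k by lia] at this
  intro n
  induction n with
  | zero => simpa using hf
  | succ n ih =>
    have := mul_mem_SigmaSet ih one_mem_SigmaSet
    rwa [mul_one, show (l - n + -1 : ℤ) = l - (n + 1 : ℕ) by push_cast; ring] at this

/-! ### Depth filtration on quasimodular forms -/

/-- The quasimodular forms of weight `k` and depth less than `N`. -/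
def quasiLT (N : ℕ) (k : ℤ) : Submodule ℂ (ℍ → ℂ) :=
  gradedSpan (fun i : Fin N ↦ E2 ^ (i : ℕ)) (fun i ↦ 2 * (i : ℤ)) k

theorem mul_E2_pow_mem_quasiLT {N i : ℕ} (hi : i < N) {l : ℤ} {p : ℍ → ℂ} (hp : p ∈ modForms l) :
    p * E2 ^ i ∈ quasiLT N (l + 2 * i) :=
  mul_mem_gradedSpan hp (generator_mem_gradedSpan (u := fun i : Fin N ↦ E2 ^ (i : ℕ))
    (w := fun i ↦ 2 * (i : ℤ)) ⟨i, hi⟩)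

theorem quasiLT_mono {M N : ℕ} (h : M ≤ N) (k : ℤ) : quasiLT M k ≤ quasiLT N k := by
  intro f hf
  have := gradedSpan_le (v := fun i : Fin N ↦ E2 ^ (i : ℕ)) (x := fun i ↦ 2 * (i : ℤ)) (d := 0)
    (fun i ↦ ?_) hf
  · rwa [add_zero] at this
  · rw [add_zero]
    exact generator_mem_gradedSpan (u := fun i : Fin N ↦ E2 ^ (i : ℕ))
      (w := fun i ↦ 2 * (i : ℤ)) ⟨i, by lia⟩

theorem mdiff_E2_pow (n : ℕ) : MDiff (E2 ^ n) := (isDClosed_E2_pow n).mdiff ⟨n, n.lt_succ_self⟩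

theorem sD_E2_pow_sub_mem (k : ℤ) (i : ℕ) :
    sD k (E2 ^ i) - (((i : ℂ) - k) * 12⁻¹) • E2 ^ (i + 1) ∈ quasiLT (i + 1) (2 * i + 2) := by
  cases i with
  | zero =>
    have h : normalizedDerivOfComplex (1 : ℍ → ℂ) = 0 := normalizedDerivOfComplex_const 1
    have h' : sD k (E2 ^ 0) - (((0 : ℕ) - k : ℂ) * 12⁻¹) • E2 ^ (0 + 1) = 0 := by
      rw [sD_eq, pow_zero, h]
      ext z
      simp
    rw [h']
    exact zero_mem _
  | succ i =>
    rw [sD_E2_pow]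
    have h : ∀ a b c : ℍ → ℂ, b = c → a + b - c = a := by
      rintro a b c rfl
      exact add_sub_cancel_right a b
    rw [h _ _ _ (by push_cast; rfl)]
    refine Submodule.smul_mem _ _ ?_
    have := mul_E2_pow_mem_quasiLT (N := i + 1 + 1) (i := i) (by lia) sD_one_E2_mem
    rwa [show (4 + 2 * i : ℤ) = 2 * (i + 1 : ℕ) + 2 by push_cast; ring] at this

theorem sD_mul_E2_pow_sub_mem (m : ℤ) {l : ℤ} {p : ℍ → ℂ} (hp : p ∈ modForms l) (i : ℕ) :
    sD m (p * E2 ^ i) - (((i + l - m : ℤ) : ℂ) * 12⁻¹) • (p * E2 ^ (i + 1)) ∈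
      quasiLT (i + 1) (l + 2 * i + 2) := by
  have h := sD_mul (k := l) (l := m - l) (mdiff_of_mem_modForms hp) (mdiff_E2_pow i)
  rw [add_sub_cancel] at h
  have h1 := mul_E2_pow_mem_quasiLT i.lt_succ_self (sD_mem_modForms hp)
  have h2 := mul_mem_gradedSpan hp (sD_E2_pow_sub_mem (m - l) i)
  rw [show l + 2 + 2 * i = l + 2 * i + 2 by ring] at h1
  rw [show l + (2 * i + 2) = l + 2 * i + 2 by ring] at h2
  convert add_mem h1 h2 using 1
  rw [h]
  ext z
  simp
  ring

theorem sD_mem_quasiLT (m : ℤ) {N : ℕ} {k : ℤ} {f : ℍ → ℂ} (hf : f ∈ quasiLT N k) :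
    MDiff f ∧ sD m f ∈ quasiLT (N + 1) (k + 2) := by
  obtain ⟨c, hc, rfl⟩ := hf
  refine Finset.sum_induction _ (fun f : ℍ → ℂ ↦ MDiff f ∧ sD m f ∈ quasiLT (N + 1) (k + 2))
    ?_ ?_ ?_
  · rintro f g ⟨hf, hf'⟩ ⟨hg, hg'⟩
    refine ⟨MDifferentiable.add hf hg, ?_⟩
    rw [sD_add hf hg]
    exact add_mem hf' hg'
  · refine ⟨mdifferentiable_const, ?_⟩
    rw [sD_zero]
    exact zero_mem _
  · intro i _
    refine ⟨(mdiff_of_mem_modForms (hc i)).mul (mdiff_E2_pow i), ?_⟩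
    have h1 := quasiLT_mono (N := N + 1) (by lia) _ (sD_mul_E2_pow_sub_mem m (hc i) i)
    have h2 := mul_E2_pow_mem_quasiLT (N := N + 1) (i := i + 1) (by lia) (hc i)
    rw [show k - 2 * (i : ℤ) + 2 * i + 2 = k + 2 by ring] at h1
    rw [show k - 2 * (i : ℤ) + 2 * (i + 1 : ℕ) = k + 2 by push_cast; ring] at h2
    have h3 := add_mem h1 (Submodule.smul_mem _
      ((((i + (k - 2 * (i : ℤ)) - m : ℤ) : ℂ)) * 12⁻¹) h2)
    rwa [sub_add_cancel] at h3

theorem eq_zero_of_mul_E2_pow_mem_quasiLT {N : ℕ} {k : ℤ} {p : ℍ → ℂ}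
    (hp : p ∈ modForms (k - 2 * N)) (h : p * E2 ^ N ∈ quasiLT N k) : p = 0 := by
  obtain ⟨c, hc, h⟩ := h
  let a : ℕ → ℍ → ℂ := fun i ↦ if hi : i < N then -c ⟨i, hi⟩ else p
  have ha : ∀ i < N + 1, a i ∈ modForms (k - 2 * i) := by
    intro i hi
    by_cases h : i < N
    · simpa [a, h] using hc ⟨i, h⟩
    · obtain rfl : i = N := by lia
      simpa [a] using hp
  have hsum : ∑ i ∈ Finset.range (N + 1), a i * E2 ^ i = 0 := by
    rw [Finset.sum_range_succ, Finset.sum_range]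
    simp only [a, Fin.is_lt, dite_true, Fin.eta, lt_irrefl, dite_false, neg_mul,
      Finset.sum_neg_distrib]
    rw [h, neg_add_cancel]
  simpa [a] using modForms_E2_independent ha hsum N N.lt_succ_self

/-- The iterate of order `n` has depth exactly `s + n`, while every other term of the equation has
smaller depth. -/
theorem notMem_SigmaSet_of_quasimodular {s : ℕ} {k m : ℤ} {f p : ℍ → ℂ}
    (hp : p ∈ modForms (k - 2 * s)) (hp0 : p ≠ 0) (hf : f - p * E2 ^ s ∈ quasiLT s k)
    (hm : k - s < m) : f ∉ SigmaSet (m : ℝ) := by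
  rintro ⟨-, n, hn⟩
  obtain ⟨g, hg, h⟩ := solvesMonicMLDE_iff.mp hn
  have key : ∀ n : ℕ, ∃ q ∈ modForms (k - 2 * s), q ≠ 0 ∧
      iterSerre (m : ℝ) n f - q * E2 ^ (s + n) ∈ quasiLT (s + n) (k + 2 * n) := by
    intro n
    induction n with
    | zero => exact ⟨p, hp, hp0, by simpa [iterSerre] using hf⟩
    | succ n ih =>
      obtain ⟨q, hq, hq0, hr⟩ := ih
      -- The integer factor equals k - s - m - n, which is negative because m > k - s.
      set c : ℂ := (((s + n : ℕ) + (k - 2 * s) - (m + 2 * n) : ℤ) : ℂ) * 12⁻¹ with hc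
      refine ⟨c • q, Submodule.smul_mem _ _ hq, smul_ne_zero ?_ hq0, ?_⟩
      · refine mul_ne_zero ?_ (by norm_num)
        rw [Int.cast_ne_zero]
        push_cast
        lia
      · have h1 := sD_mul_E2_pow_sub_mem (m + 2 * n) hq (s + n)
        obtain ⟨hd, h2⟩ := sD_mem_quasiLT (m + 2 * n) hr
        rw [show k - 2 * s + 2 * (s + n : ℕ) + 2 = k + 2 * (n + 1 : ℕ) by push_cast; ring] at h1
        rw [show k + 2 * n + 2 = k + 2 * (n + 1 : ℕ) by push_cast; ring] at h2
        have h3 := sD_add (k := m + 2 * n) hd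
          ((mdiff_of_mem_modForms hq).mul (mdiff_E2_pow (s + n)))
        rw [sub_add_cancel] at h3
        rw [iterSerre_succ, h3, smul_mul_assoc, add_sub_assoc]
        exact add_mem h2 h1
  obtain ⟨q, hq, hq0, hr⟩ := key n
  refine hq0 (eq_zero_of_mul_E2_pow_mem_quasiLT (N := s + n) (k := k + 2 * n) ?_ ?_)
  · rwa [show k + 2 * n - 2 * (s + n : ℕ) = k - 2 * s by push_cast; ring]
  · have hsum : ∑ i ∈ Finset.Icc 1 n, g i * iterSerre (m : ℝ) (n - i) f ∈
        quasiLT (s + n) (k + 2 * n) := by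
      refine sum_mem fun i hi ↦ ?_
      rw [Finset.mem_Icc] at hi
      obtain ⟨q', hq', -, hr'⟩ := key (n - i)
      have h1 := mul_E2_pow_mem_quasiLT (N := s + n) (i := s + (n - i)) (by lia) hq'
      have h2 := quasiLT_mono (N := s + n) (by lia) _ hr'
      rw [show k - 2 * s + 2 * (s + (n - i) : ℕ) = k + 2 * (n - i : ℕ) by push_cast; ring] at h1
      have h3 := mul_mem_gradedSpan (hg i) (add_mem h2 h1)
      rw [sub_add_cancel] at h3
      rwa [show 2 * i + (k + 2 * (n - i : ℕ)) = k + 2 * n by lia] at h3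
    rw [eq_neg_of_add_eq_zero_left h] at hr
    have := neg_mem (add_mem hr hsum)
    convert this using 1
    abel

/-- Expanding `P` in powers of its first variable gives coefficients homogeneous in E₄ and E₆; a
nonzero one remains nonzero as a function by `eq_zero_of_ev_eq_zero`. -/
theorem IsQuasimodular.exists_leading {k s : ℕ} {f : ℍ → ℂ} (h : IsQuasimodular k s f)
    (hf : f ≠ 0) : ∃ p ∈ modForms ((k : ℤ) - 2 * s), p ≠ 0 ∧ f - p * E2 ^ s ∈ quasiLT s k := by
  obtain ⟨P, hP, hdeg, hev⟩ := h
  set Q := MvPolynomial.finSuccEquiv ℂ 2 P with hQ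
  have hQd : Q.natDegree = s := by rw [hQ, MvPolynomial.natDegree_finSuccEquiv, hdeg]
  have hwh : ∀ i, (Q.coeff i).IsWeightedHomogeneous wt ((k : ℤ) - 2 * i) := by
    intro i d hd
    rw [hQ, MvPolynomial.finSuccEquiv_coeff_coeff] at hd
    have := hP hd
    rw [Finsupp.weight_apply, Finsupp.sum_fintype _ _ (by simp), Fin.sum_univ_three] at this
    rw [weight_wt]
    have h1 : (Finsupp.cons i d : Fin 3 →₀ ℕ) 1 = d 0 := Finsupp.cons_succ 0 i d
    have h2 : (Finsupp.cons i d : Fin 3 →₀ ℕ) 2 = d 1 := Finsupp.cons_succ 1 i d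
    simp [h1, h2] at this
    lia
  have hsum : f = ∑ i ∈ Finset.range (s + 1), ev (Q.coeff i) * E2 ^ i := by
    ext z
    rw [hev, show (![E2 z, E₄ z, E₆ z] : Fin 3 → ℂ) = Fin.cons (E2 z) ![E₄ z, E₆ z] from rfl,
      MvPolynomial.eval_eq_eval_mv_eval', Polynomial.eval_map, Polynomial.eval₂_eq_sum_range,
      ← hQ, hQd, Finset.sum_apply]
    simp [ev_apply]
  -- The zero polynomial also has degree 0; `f ≠ 0` rules it out.
  have hlead : Q.coeff s ≠ 0 := by
    rw [← hQd, Polynomial.coeff_natDegree, Polynomial.leadingCoeff_ne_zero]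
    intro h0
    apply hf
    rw [hsum, h0]
    simp
  refine ⟨ev (Q.coeff s), ev_mem_modForms (hwh s),
    fun h0 ↦ hlead (eq_zero_of_ev_eq_zero (hwh s) h0), ?_⟩
  rw [hsum, Finset.sum_range_succ, add_sub_cancel_right]
  refine sum_mem fun i hi ↦ ?_
  have := mul_E2_pow_mem_quasiLT (Finset.mem_range.mp hi) (ev_mem_modForms (hwh i))
  rwa [sub_add_cancel] at this

theorem mem_SigmaSet_of_quasimodular {s : ℕ} {k : ℤ} {f p : ℍ → ℂ}
    (hp : p ∈ modForms (k - 2 * s)) (hf : f - p * E2 ^ s ∈ quasiLT s k) :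
    f ∈ SigmaSet ((k - s : ℤ) : ℝ) := by
  refine mem_SigmaSet_of_mem_gradedSpan (isDClosed_E2_pow s) ?_
  have h1 := quasiLT_mono s.le_succ _ hf
  have h2 := mul_E2_pow_mem_quasiLT s.lt_succ_self hp
  rw [sub_add_cancel] at h2
  have h3 := add_mem h1 h2
  rw [sub_add_cancel] at h3
  exact gradedSpan_le (d := -(s : ℤ)) (fun i ↦ generator_mem_gradedSpan
    (u := fun i : Fin (s + 1) ↦ E2 ^ (i : ℕ)) (w := fun i ↦ 2 * (i : ℤ) - s) i) h3

/-! ### Arithmetic of the differential weight -/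

/-- Antitonicity of `SigmaSet` leaves no gaps below the supremum, so inequalities for `dwt` reduce
to memberships. -/
theorem coe_le_dwt_iff {f : ℍ → ℂ} {k : ℤ} :
    ((k : WithTop ℤ) : WithBot (WithTop ℤ)) ≤ dwt f ↔ f ∈ SigmaSet (k : ℝ) := by
  refine ⟨fun h ↦ ?_, fun h ↦ le_sSup ⟨k, h, rfl⟩⟩
  by_contra hk
  have hle : dwt f ≤ (((k - 1 : ℤ) : WithTop ℤ) : WithBot (WithTop ℤ)) := by
    refine sSup_le ?_
    rintro x ⟨m, hm, rfl⟩
    have : m < k := by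
      by_contra hmk
      exact hk (SigmaSet_antitone (not_lt.mp hmk) hm)
    have : m ≤ k - 1 := by lia
    exact_mod_cast this
  have h' := h.trans hle
  have : k ≤ k - 1 := by exact_mod_cast h'
  lia

theorem le_of_forall_coe_le {x y : WithBot (WithTop ℤ)}
    (h : ∀ n : ℤ, ((n : WithTop ℤ) : WithBot (WithTop ℤ)) ≤ x →
      ((n : WithTop ℤ) : WithBot (WithTop ℤ)) ≤ y) : x ≤ y := by
  induction x with
  | bot => exact bot_le
  | coe x =>
    induction x with
    | coe x => exact h x le_rfl
    | top =>
      induction y with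
      | bot =>
        exact absurd (h 0 (WithBot.coe_le_coe.mpr le_top)) (by simp)
      | coe y =>
        induction y with
        | top => exact le_rfl
        | coe y =>
          have := h (y + 1) (WithBot.coe_le_coe.mpr le_top)
          rw [WithBot.coe_le_coe, WithTop.coe_le_coe] at this
          lia

theorem exists_coe_le_of_coe_le_add {x y : WithBot (WithTop ℤ)} {n : ℤ}
    (h : ((n : WithTop ℤ) : WithBot (WithTop ℤ)) ≤ x + y) :
    ∃ a b : ℤ, ((a : WithTop ℤ) : WithBot (WithTop ℤ)) ≤ x ∧
      ((b : WithTop ℤ) : WithBot (WithTop ℤ)) ≤ y ∧ n ≤ a + b := by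
  have htop : ∀ a : ℤ, ((a : WithTop ℤ) : WithBot (WithTop ℤ)) ≤ ((⊤ : WithTop ℤ) : _) :=
    fun a ↦ WithBot.coe_le_coe.mpr le_top
  induction x with
  | bot => simp at h
  | coe x =>
    induction y with
    | bot => simp at h
    | coe y =>
      induction x with
      | top =>
        induction y with
        | top => exact ⟨n, 0, htop _, htop _, by lia⟩
        | coe y => exact ⟨n - y, y, htop _, le_rfl, by lia⟩
      | coe x =>
        induction y with
        | top => exact ⟨x, n - x, le_rfl, htop _, by lia⟩
        | coe y => exact ⟨x, y, le_rfl, le_rfl, by exact_mod_cast h⟩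

theorem min_dwt_le_dwt_add (f g : ℍ → ℂ) : min (dwt f) (dwt g) ≤ dwt (f + g) := by
  refine le_of_forall_coe_le fun n hn ↦ ?_
  rw [le_min_iff, coe_le_dwt_iff, coe_le_dwt_iff] at hn
  exact coe_le_dwt_iff.mpr (add_mem_SigmaSet hn.1 hn.2)

theorem dwt_neg (f : ℍ → ℂ) : dwt (-f) = dwt f := by
  refine le_antisymm ?_ ?_ <;> refine le_of_forall_coe_le fun n hn ↦ ?_ <;>
    rw [coe_le_dwt_iff] at hn ⊢
  · simpa using neg_mem_SigmaSet hn
  · exact neg_mem_SigmaSet hn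

theorem dwt_add_dwt_le (f g : ℍ → ℂ) : dwt f + dwt g ≤ dwt (f * g) := by
  refine le_of_forall_coe_le fun n hn ↦ ?_
  obtain ⟨a, b, ha, hb, hab⟩ := exists_coe_le_of_coe_le_add hn
  rw [coe_le_dwt_iff] at ha hb ⊢
  exact SigmaSet_antitone hab (mul_mem_SigmaSet ha hb)

/-- The usual ultrametric argument, writing g = (f + g) + (-f). -/
theorem dwt_add_eq_of_lt {f g : ℍ → ℂ} (h : dwt g < dwt f) : dwt (f + g) = dwt g := by
  refine le_antisymm ?_ ?_
  · by_contra! hlt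
    have h1 := min_dwt_le_dwt_add (f + g) (-f)
    rw [dwt_neg, add_neg_cancel_comm] at h1
    exact absurd h1 (not_le.mpr (lt_min hlt h))
  · simpa [h.le] using min_dwt_le_dwt_add f g

end MLDE

end

theorem mainTheorem2 :
    (∀ f g : ℍ → ℂ, MDiff f → MDiff g →
      MLDE.dwt f + MLDE.dwt g ≤ MLDE.dwt (f * g)) ∧
    (∀ f g : ℍ → ℂ, MDiff f → MDiff g → MLDE.dwt f = MLDE.dwt g →
      MLDE.dwt g ≤ MLDE.dwt (f + g)) ∧
    (∀ f g : ℍ → ℂ, MDiff f → MDiff g → MLDE.dwt g < MLDE.dwt f →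
      MLDE.dwt (f + g) = MLDE.dwt g) ∧
    (∀ (k s : ℕ) (f : ℍ → ℂ), f ≠ 0 → MLDE.IsQuasimodular k s f →
      MLDE.dwt f = ((((k : ℤ) - (s : ℤ) : ℤ) : WithTop ℤ) : WithBot (WithTop ℤ)) ∧
      f ∈ MLDE.SigmaSet (((k : ℤ) - (s : ℤ) : ℤ) : ℝ) ∧
      ∀ m : ℤ, (k : ℤ) - (s : ℤ) < m → f ∉ MLDE.SigmaSet (m : ℝ)) := by
  refine ⟨fun f g _ _ ↦ MLDE.dwt_add_dwt_le f g, fun f g _ _ h ↦ ?_,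
    fun f g _ _ h ↦ MLDE.dwt_add_eq_of_lt h, fun k s f hf hq ↦ ?_⟩
  · simpa [h] using MLDE.min_dwt_le_dwt_add f g
  · obtain ⟨p, hp, hp0, hr⟩ := hq.exists_leading hf
    have hmem := MLDE.mem_SigmaSet_of_quasimodular hp hr
    have hnot : ∀ m : ℤ, (k : ℤ) - (s : ℤ) < m → f ∉ MLDE.SigmaSet (m : ℝ) :=
      fun m hm ↦ MLDE.notMem_SigmaSet_of_quasimodular hp hp0 hr hm
    refine ⟨(MLDE.dwt_eq_coe_iff _ _).mpr ⟨hmem, fun m hm ↦ ?_⟩, hmem, hnot⟩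
    by_contra! hlt
    exact hnot m hlt hm
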